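/- Let $K$ be a field, let $T$ be a (finite) tree with vertex set $V$, and let $R=K[x_a : a\in V]$ with the standard grading. For a graph $G$ whose vertices belong to $V$, let $I(G)\subset R$ be the edge ideal of $G$, i.e. the ideal generated by the monomials $x_ax_b$ such that $\{a,b\}$ is an edge of $G$. For $r,d\in\mathbb Z$ let $\beta_{r,d}(R/I(G))$ be the graded Betti number of $R/I(G)$, i.e. the number of summands $R(-d)$ in the $r$th module of the minimal graded free resolution of $R/I(G)$ over $R$ (so it is $0$ for $r<0$), and let $\operatorname{pd}(R/I(G))$ be the projective dimension of the $R$-module $R/I(G)$. Theorem (Jacques' recursion). Let $v$ be a vertex of $T$ and let $v_1,\dots,v_n$ ($n\ge 1$) be its distinct neighbours. Suppose that all of them, except possibly $v_n$, are leaves (vertices of degree one), and that $v_1$ is a leaf (which is automatic if $n\geq 2$). Let $T'$ be the subgraph of $T$ obtained by deleting the vertex $v_1$, and let $T''$ be the one obtained by deleting the vertices $v,v_1,\dots,v_n$. Then, for all integers $r,d$, $$\beta_{r,d}(R/I(T))=\beta_{r,d}(R/I(T'))+\sum_{j=0}^{n-1}\binom{n-1}{j}\,\beta_{r-(j+1),\,d-(j+2)}(R/I(T'')).$$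 Moreover, $$\operatorname{pd}(R/I(T))=\max\{\operatorname{pd}(R/I(T')),\ \operatorname{pd}(R/I(T''))+n\}.$$ -/

import Mathlib

namespace EdgeIdealBetti

open MvPolynomial

universe u v

variable {V : Type u} {K : Type v} [Field K]

/-- The edge ideal of a simple graph `G` on the vertex set `V`: the ideal of `R = K[x_a : a ∈ V]`
generated by the monomials `x_a x_b` such that `{a, b}` is an edge of `G`. -/
noncomputable def edgeIdeal (K : Type v) [Field K] (G : SimpleGraph V) : Ideal (MvPolynomial V K) :=
  Ideal.span {p | ∃ a b : V, G.Adj a b ∧ p = X a * X b}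

/-- Membership in the degree `d` component `R_d` of the standard grading of `R = K[x_a : a ∈ V]`,
for an integer `d` (so `R_d = 0` for `d < 0`). -/
def InDegree (p : MvPolynomial V K) (d : ℤ) : Prop :=
  p = 0 ∨ ∃ k : ℕ, (k : ℤ) = d ∧ p.IsHomogeneous k

/-- A minimal graded free resolution
`⋯ ⟶ F_2 ⟶ F_1 ⟶ F_0 ⟶ R ⧸ I ⟶ 0` of `R ⧸ I` by finitely generated graded free modules, where
`R = K[x_a : a ∈ V]` has the standard grading and `I` is a homogeneous ideal. The module `F_r` is
`⨁_i R(-deg r i)`, i.e. the free module with basis elements `e_i = Pi.single i 1` placed in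
degree `deg r i`; the maps are homogeneous of degree `0`. -/
structure MinimalGradedFreeResolution (I : Ideal (MvPolynomial V K)) where
  /-- the rank of `F_r` -/
  rank : ℕ → ℕ
  /-- the degrees of the basis elements of `F_r` -/
  deg : (r : ℕ) → Fin (rank r) → ℤ
  /-- the differential `F_{r+1} ⟶ F_r` -/
  diff : (r : ℕ) →
    (Fin (rank (r + 1)) → MvPolynomial V K) →ₗ[MvPolynomial V K]
      (Fin (rank r) → MvPolynomial V K)
  /-- the augmentation `F_0 ⟶ R ⧸ I` -/
  aug : (Fin (rank 0) → MvPolynomial V K) →ₗ[MvPolynomial V K] (MvPolynomial V K ⧸ I)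
  /-- The differentials are homogeneous of degree `0`. -/
  diff_homogeneous : ∀ (r : ℕ) (j : Fin (rank (r + 1))) (i : Fin (rank r)),
    InDegree (diff r (Pi.single j 1) i) (deg (r + 1) j - deg r i)
  /-- The augmentation is homogeneous of degree `0`. -/
  aug_homogeneous : ∀ i : Fin (rank 0), ∃ p : MvPolynomial V K,
    InDegree p (deg 0 i) ∧ aug (Pi.single i 1) = Ideal.Quotient.mk I p
  aug_surjective : Function.Surjective aug
  exact_zero : Function.Exact (diff 0) aug
  exact_succ : ∀ r : ℕ, Function.Exact (diff (r + 1)) (diff r)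
  /-- Minimality: the image of `F_{r+1}` is contained in `𝔪 F_r`, where `𝔪 = (x_a : a ∈ V)`. -/
  minimal : ∀ (r : ℕ) (f : Fin (rank (r + 1)) → MvPolynomial V K) (i : Fin (rank r)),
    diff r f i ∈ Ideal.span (Set.range (X : V → MvPolynomial V K))

/-- The number of basis elements of degree `d` of `F_r`, i.e. the number of direct summands
`R(-d)` of `F_r`; it is `0` for `r < 0`. -/
def MinimalGradedFreeResolution.count {I : Ideal (MvPolynomial V K)}
    (F : MinimalGradedFreeResolution I) (r d : ℤ) : ℕ :=
  if 0 ≤ r then (Finset.univ.filter fun i => F.deg r.toNat i = d).card else 0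

open Classical in
/-- The graded Betti number `β_{r,d}(R ⧸ I)` of a homogeneous ideal `I` of `R = K[x_a : a ∈ V]`,
`V` finite: the number of direct summands `R(-d)` in the `r`th module of a minimal graded free
resolution of `R ⧸ I`. (Such a resolution exists and is unique up to isomorphism, hence the number
is independent of the choice; for other ideals, which need not have one, the value is `0`.) -/
noncomputable def gradedBetti (I : Ideal (MvPolynomial V K)) (r d : ℤ) : ℕ :=
  if h : Nonempty (MinimalGradedFreeResolution I) then h.some.count r d else 0

/-- The projective dimension of the `R`-module `R ⧸ I`. -/
noncomputable def pd (I : Ideal (MvPolynomial V K)) : WithBot ℕ∞ :=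
  CategoryTheory.projectiveDimension
    (ModuleCat.of (MvPolynomial V K) (MvPolynomial V K ⧸ I))

/-- The graph obtained from `G` by eliminating the vertices in `S`, seen as a set of edges on
the vertices of `G`: an edge of `G` remains if and only if neither of its ends is in `S`. Its edge
ideal in `K[x_a : a ∈ V]` is thus the ideal generated by the edge monomials of the subgraph. -/
def eliminate (G : SimpleGraph V) (S : Set V) : SimpleGraph V :=
  ((⊤ : G.Subgraph).deleteVerts S).spanningCoe

end EdgeIdealBetti

/-!
Let `x = v₁`, `y = v`, `I = I(T)`, `I' = I(T')`. As `x` is a leaf, `I = I' + (x y)`, and no generator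
of `I'` involves `x`, so `L = I' : (x y) = I' : y`. This colon ideal is generated by the neighbours
`v₂, …, vₙ` of `y` and by the edges that avoid `y` and its neighbours, that is
`L = I(T'') + (v₂, …, vₙ)` (`mem_colon_of_mul_mem`, `X_mul_mem_of_mem_colon`). Hence there is a short
exact sequence `0 ⟶ (R ⧸ L)(-2) ⟶ R ⧸ I' ⟶ R ⧸ I ⟶ 0` whose first map is multiplication by `x y`,
and the mapping cone of a lift of this map to minimal resolutions resolves `R ⧸ I`. Since `y L ⊆ I'`,
multiplication by `y` already lifts to the resolutions, and `x` times this lift has entries in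
`𝔪 = (x_a : a ∈ V)`: the cone is minimal (`MinimalGradedFreeResolution.exists_cone`), so
`β_{r,d}(R ⧸ I) = β_{r,d}(R ⧸ I') + β_{r-1,d-2}(R ⧸ L)`. The variables `v₂, …, vₙ` form a regular
sequence modulo `I(T'')`; adding them one at a time is another instance of the cone (with `L = J` and
`1` in place of `y`), and Pascal's rule yields the binomial coefficients
(`exists_resolution_sup_span_X`).

The Betti number may be read off from any minimal graded free resolution
(`MinimalGradedFreeResolution.gradedBetti_eq_count`): two resolutions are related by homogeneous
chain maps whose composites are homotopic to the identity, hence equal to it modulo `𝔪`. Minimal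
resolutions for forests exist by induction on the edges, again through the cone of a leaf
(`exists_resolution_of_isAcyclic`).

For the projective dimension, `pd (R ⧸ I) < n` holds if and only if the `n`th module of a minimal
resolution vanishes (`MinimalGradedFreeResolution.hasProjectiveDimensionLT_iff`), by Nakayama's lemma
applied to the syzygies. So the projective dimension is determined by the vanishing of the graded
Betti numbers, and its recursion follows from theirs (`pd_eq_max_of_gradedBetti`).
-/

namespace EdgeIdealBetti

open MvPolynomial

universe u v

variable {V : Type u} {K : Type v} [Field K]

attribute [local instance] MvPolynomial.gradedAlgebra

/-! ### Homogeneous components in integer degrees -/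

theorem InDegree.zero (d : ℤ) : InDegree (0 : MvPolynomial V K) d := Or.inl rfl

theorem InDegree.neg {p : MvPolynomial V K} {d : ℤ} (h : InDegree p d) : InDegree (-p) d := by
  rcases h with rfl | ⟨k, hk, hp⟩
  · simpa using InDegree.zero d
  · exact Or.inr ⟨k, hk, hp.neg⟩

theorem InDegree.mul {p q : MvPolynomial V K} {a b : ℤ} (hp : InDegree p a) (hq : InDegree q b) :
    InDegree (p * q) (a + b) := by
  rcases hp with rfl | ⟨k, rfl, hp⟩
  · simpa using InDegree.zero _
  rcases hq with rfl | ⟨l, rfl, hq⟩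
  · simpa using InDegree.zero _
  exact Or.inr ⟨k + l, by push_cast; rfl, hp.mul hq⟩

theorem inDegree_X (a : V) : InDegree (X a : MvPolynomial V K) 1 :=
  Or.inr ⟨1, rfl, isHomogeneous_X K a⟩

theorem inDegree_one : InDegree (1 : MvPolynomial V K) 0 :=
  Or.inr ⟨0, rfl, isHomogeneous_one V K⟩

theorem InDegree.eq_zero_of_constantCoeff_ne_zero {p : MvPolynomial V K} {d : ℤ}
    (hp : InDegree p d) (h : constantCoeff p ≠ 0) : d = 0 := by
  rcases hp with rfl | ⟨k, rfl, hp⟩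
  · simp at h
  · by_contra hk
    exact h (hp.coeff_eq_zero (d := 0) (by simpa using fun h => hk (by simp [← h])))

/-- The homogeneous component of degree `d ∈ ℤ` of a polynomial; it is `0` for `d < 0`. -/
noncomputable def component (d : ℤ) : MvPolynomial V K →ₗ[K] MvPolynomial V K :=
  if 0 ≤ d then homogeneousComponent d.toNat else 0

theorem inDegree_component (d : ℤ) (p : MvPolynomial V K) : InDegree (component d p) d := by
  unfold component
  split_ifs with h
  · exact Or.inr ⟨d.toNat, by omega, homogeneousComponent_isHomogeneous _ _⟩
  · exact InDegree.zero d

theorem InDegree.component_eq {p : MvPolynomial V K} {d : ℤ} (hp : InDegree p d) :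
    component d p = p := by
  rcases hp with rfl | ⟨k, rfl, hp⟩
  · simp
  · simpa [component] using homogeneousComponent_eq_self hp

theorem component_mem {J : Ideal (MvPolynomial V K)}
    (hJ : J.IsHomogeneous (homogeneousSubmodule V K)) {p : MvPolynomial V K} (hp : p ∈ J) (d : ℤ) :
    component d p ∈ J := by
  unfold component
  split_ifs with h
  · exact homogeneousComponent_mem_of_mem hJ hp _
  · simp

theorem component_mul (d : ℤ) {m : ℤ} (p : MvPolynomial V K) {q : MvPolynomial V K}
    (hq : InDegree q m) : component (d + m) (p * q) = component d p * q := by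
  rcases hq with rfl | ⟨k, rfl, hq⟩
  · simp
  have key : ∀ n (r : MvPolynomial V K), homogeneousComponent n r =
      (DirectSum.decompose (homogeneousSubmodule V K) r n : MvPolynomial V K) :=
    fun n r => (decomposition.decompose'_apply r n).symm
  unfold component
  by_cases hd : 0 ≤ d
  · lift d to ℕ using hd
    rw [if_pos (by omega), if_pos (by omega)]
    have : ((d : ℤ) + (k : ℤ)).toNat = d + k := by omega
    rw [this, key, key, Int.toNat_natCast]
    exact DirectSum.coe_decompose_mul_add_of_right_mem _ hq
  · rw [if_neg hd]
    split_ifs with h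
    · rw [key]
      rw [DirectSum.coe_decompose_mul_of_right_mem_of_not_le (homogeneousSubmodule V K) hq
        (by omega)]
      simp
    · simp

theorem constantCoeff_eq_zero_of_mem {p : MvPolynomial V K}
    (hp : p ∈ Ideal.span (Set.range (X : V → MvPolynomial V K))) : constantCoeff p = 0 := by
  have : Ideal.span (Set.range (X : V → MvPolynomial V K)) ≤ RingHom.ker constantCoeff := by
    rw [Ideal.span_le]
    rintro _ ⟨a, rfl⟩
    simp
  exact this hp

/-! ### Homogeneous maps of graded free modules -/

/-- A linear map between the graded free modules `⨁_j R(-a j)` and `⨁_i R(-b i)` is homogeneous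
of degree `k`. -/
def HomogeneousMap {m n : Type*} [DecidableEq m] (k : ℤ) (a : m → ℤ) (b : n → ℤ)
    (φ : (m → MvPolynomial V K) →ₗ[MvPolynomial V K] (n → MvPolynomial V K)) : Prop :=
  ∀ j i, InDegree (φ (Pi.single j 1) i) (a j + k - b i)

theorem linearMap_apply_eq_sum {m M : Type*} [Fintype m] [DecidableEq m] {R : Type*} [CommRing R]
    [AddCommGroup M] [Module R M] (φ : (m → R) →ₗ[R] M) (f : m → R) :
    φ f = ∑ j, f j • φ (Pi.single j 1) := by
  conv_lhs => rw [← (Pi.basisFun R m).sum_repr f]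
  simp

theorem exists_linearMap_single {m M : Type*} [Fintype m] [DecidableEq m] {R : Type*} [CommRing R]
    [AddCommGroup M] [Module R M] {P : m → M → Prop} (h : ∀ j, ∃ y, P j y) :
    ∃ φ : (m → R) →ₗ[R] M, ∀ j, P j (φ (Pi.single j 1)) := by
  choose y hy using h
  refine ⟨(Pi.basisFun R m).constr R y, fun j => ?_⟩
  have := (Pi.basisFun R m).constr_basis R y j
  rw [Pi.basisFun_apply] at this
  rw [this]
  exact hy j

/-- Taking the component of degree `e` of a vector commutes with a homogeneous map. -/
theorem HomogeneousMap.component_apply {m n : Type*} [Fintype m] [DecidableEq m] {a : m → ℤ}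
    {b : n → ℤ} {k : ℤ}
    {φ : (m → MvPolynomial V K) →ₗ[MvPolynomial V K] (n → MvPolynomial V K)}
    (hφ : HomogeneousMap k a b φ) (e : ℤ) (y : m → MvPolynomial V K) (i : n) :
    φ (fun j => component (e - a j) (y j)) i = component (e + k - b i) (φ y i) := by
  rw [linearMap_apply_eq_sum φ, linearMap_apply_eq_sum φ y]
  simp only [Finset.sum_apply, Pi.smul_apply, smul_eq_mul, map_sum]
  refine Finset.sum_congr rfl fun j _ => ?_
  rw [← component_mul _ _ (hφ j i)]
  congr 2
  ring

namespace MinimalGradedFreeResolution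

variable {I J L : Ideal (MvPolynomial V K)}

theorem homogeneousMap_diff (F : MinimalGradedFreeResolution I) (r : ℕ) :
    HomogeneousMap 0 (F.deg (r + 1)) (F.deg r) (F.diff r) := fun j i => by
  simpa using F.diff_homogeneous r j i

theorem diff_diff (F : MinimalGradedFreeResolution I) (r : ℕ)
    (f : Fin (F.rank (r + 2)) → MvPolynomial V K) : F.diff r (F.diff (r + 1) f) = 0 :=
  (F.exact_succ r).apply_apply_eq_zero f

theorem aug_diff (F : MinimalGradedFreeResolution I)
    (f : Fin (F.rank 1) → MvPolynomial V K) : F.aug (F.diff 0 f) = 0 :=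
  F.exact_zero.apply_apply_eq_zero f

theorem exists_homogeneous_diff_eq (F : MinimalGradedFreeResolution I) (r : ℕ) (e : ℤ)
    {z : Fin (F.rank r) → MvPolynomial V K} (hz : z ∈ Set.range (F.diff r))
    (hz' : ∀ i, InDegree (z i) (e - F.deg r i)) :
    ∃ y : Fin (F.rank (r + 1)) → MvPolynomial V K,
      F.diff r y = z ∧ ∀ j, InDegree (y j) (e - F.deg (r + 1) j) := by
  obtain ⟨y, rfl⟩ := hz
  refine ⟨fun j => component (e - F.deg (r + 1) j) (y j), ?_, fun j => inDegree_component _ _⟩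
  ext1 i
  rw [(F.homogeneousMap_diff r).component_apply, add_zero, (hz' i).component_eq]

theorem exists_homogeneous_aug_eq (F : MinimalGradedFreeResolution I)
    (hI : I.IsHomogeneous (homogeneousSubmodule V K)) {e : ℤ} {p : MvPolynomial V K}
    (hp : InDegree p e) :
    ∃ y : Fin (F.rank 0) → MvPolynomial V K,
      F.aug y = Ideal.Quotient.mk I p ∧ ∀ j, InDegree (y j) (e - F.deg 0 j) := by
  obtain ⟨y, hy⟩ := F.aug_surjective (Ideal.Quotient.mk I p)
  choose q hq hq' using F.aug_homogeneous
  have hsum : ∀ f : Fin (F.rank 0) → MvPolynomial V K,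
      F.aug f = Ideal.Quotient.mk I (∑ j, f j * q j) := by
    intro f
    rw [linearMap_apply_eq_sum F.aug, map_sum]
    refine Finset.sum_congr rfl fun j _ => ?_
    rw [hq', map_mul]
    rfl
  refine ⟨fun j => component (e - F.deg 0 j) (y j), ?_, fun j => inDegree_component _ _⟩
  rw [hsum, Ideal.Quotient.eq] at hy ⊢
  have h := component_mem hI hy e
  rw [map_sub, hp.component_eq, map_sum] at h
  convert h using 3 with j
  rw [← component_mul _ _ (hq j)]
  congr 1
  ring_nf

/-! ### Comparison of resolutions -/

/-- A homogeneous map which is compatible with the boundaries lifts one step further. -/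
theorem exists_lift_succ (G : MinimalGradedFreeResolution L) (F : MinimalGradedFreeResolution J)
    {k : ℤ} {r : ℕ} {φ : (Fin (G.rank r) → MvPolynomial V K) →ₗ[MvPolynomial V K]
      (Fin (F.rank r) → MvPolynomial V K)}
    (hφ : HomogeneousMap k (G.deg r) (F.deg r) φ)
    (hrange : ∀ f, φ (G.diff r f) ∈ Set.range (F.diff r)) :
    ∃ φ' : (Fin (G.rank (r + 1)) → MvPolynomial V K) →ₗ[MvPolynomial V K]
      (Fin (F.rank (r + 1)) → MvPolynomial V K),
      HomogeneousMap k (G.deg (r + 1)) (F.deg (r + 1)) φ' ∧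
      (∀ f, F.diff r (φ' f) = φ (G.diff r f)) ∧
      ∀ f, φ' (G.diff (r + 1) f) ∈ Set.range (F.diff (r + 1)) := by
  have h : ∀ j, ∃ y : Fin (F.rank (r + 1)) → MvPolynomial V K,
      F.diff r y = φ (G.diff r (Pi.single j 1)) ∧
        ∀ i, InDegree (y i) (G.deg (r + 1) j + k - F.deg (r + 1) i) := by
    intro j
    refine F.exists_homogeneous_diff_eq r _ (hrange _) fun i => ?_
    have hd : G.diff r (Pi.single j 1) =
        fun l => component (G.deg (r + 1) j - G.deg r l) (G.diff r (Pi.single j 1) l) := by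
      ext1 l
      rw [(G.diff_homogeneous r j l).component_eq]
    rw [hd, hφ.component_apply]
    exact inDegree_component _ _
  obtain ⟨φ', hφ'⟩ := exists_linearMap_single (R := MvPolynomial V K) h
  have hcomm : F.diff r ∘ₗ φ' = φ ∘ₗ G.diff r := by
    refine (Pi.basisFun _ _).ext fun j => ?_
    simpa using (hφ' j).1
  have hcomm' : ∀ f, F.diff r (φ' f) = φ (G.diff r f) := fun f => LinearMap.congr_fun hcomm f
  refine ⟨φ', fun j i => (hφ' j).2 i, hcomm', fun f => ?_⟩
  rw [← F.exact_succ r, hcomm', G.diff_diff, map_zero]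

/-- Multiplication by a homogeneous `q` of degree `k`, as a map `R ⧸ L ⟶ R ⧸ J`, lifts to a
homogeneous map of degree `k` of resolutions. -/
theorem exists_chainMap (G : MinimalGradedFreeResolution L) (F : MinimalGradedFreeResolution J)
    (hJ : J.IsHomogeneous (homogeneousSubmodule V K)) {q : MvPolynomial V K} {k : ℤ}
    (hq : InDegree q k) (hqL : ∀ p ∈ L, q * p ∈ J) :
    ∃ φ : ∀ r, (Fin (G.rank r) → MvPolynomial V K) →ₗ[MvPolynomial V K]
        (Fin (F.rank r) → MvPolynomial V K),
      (∀ r, HomogeneousMap k (G.deg r) (F.deg r) (φ r)) ∧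
      (∀ r f, F.diff r (φ (r + 1) f) = φ r (G.diff r f)) ∧
      ∀ f p, G.aug f = Ideal.Quotient.mk L p →
        F.aug (φ 0 f) = Ideal.Quotient.mk J (q * p) := by
  choose p hp hp' using G.aug_homogeneous
  have h0 : ∀ j, ∃ y : Fin (F.rank 0) → MvPolynomial V K,
      F.aug y = Ideal.Quotient.mk J (q * p j) ∧
        ∀ i, InDegree (y i) (G.deg 0 j + k - F.deg 0 i) := by
    intro j
    refine F.exists_homogeneous_aug_eq hJ ?_
    rw [add_comm]
    exact hq.mul (hp j)
  obtain ⟨φ₀, hφ₀⟩ := exists_linearMap_single (R := MvPolynomial V K) h0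
  have haug : ∀ f s, G.aug f = Ideal.Quotient.mk L s →
      F.aug (φ₀ f) = Ideal.Quotient.mk J (q * s) := by
    intro f s hs
    have h1 : Ideal.Quotient.mk L (∑ j, f j * p j) = Ideal.Quotient.mk L s := by
      rw [← hs, linearMap_apply_eq_sum G.aug, map_sum]
      refine Finset.sum_congr rfl fun j _ => ?_
      rw [hp', map_mul]
      rfl
    have h2 : F.aug (φ₀ f) = Ideal.Quotient.mk J (q * ∑ j, f j * p j) := by
      rw [← LinearMap.comp_apply, linearMap_apply_eq_sum (F.aug ∘ₗ φ₀), Finset.mul_sum, map_sum]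
      refine Finset.sum_congr rfl fun j _ => ?_
      rw [LinearMap.comp_apply, (hφ₀ j).1, mul_left_comm, map_mul]
      rfl
    rw [h2, Ideal.Quotient.eq, ← mul_sub]
    exact hqL _ (Ideal.Quotient.eq.1 h1)
  have hr0 : ∀ f, φ₀ (G.diff 0 f) ∈ Set.range (F.diff 0) := by
    intro f
    rw [← F.exact_zero, haug _ 0 (by rw [G.aug_diff, map_zero]), mul_zero, map_zero]
  let S (r : ℕ) := {φ : (Fin (G.rank r) → MvPolynomial V K) →ₗ[MvPolynomial V K]
        (Fin (F.rank r) → MvPolynomial V K) // HomogeneousMap k (G.deg r) (F.deg r) φ ∧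
        ∀ f, φ (G.diff r f) ∈ Set.range (F.diff r)}
  have hstep : ∀ r (φ : S r), ∃ φ' : S (r + 1), ∀ f, F.diff r (φ'.1 f) = φ.1 (G.diff r f) := by
    rintro r ⟨φ, h1, h2⟩
    obtain ⟨φ', h3, h4, h5⟩ := exists_lift_succ G F h1 h2
    exact ⟨⟨φ', h3, h5⟩, h4⟩
  choose next hnext using hstep
  let seq : ∀ r, S r := fun r => Nat.rec ⟨φ₀, fun j i => (hφ₀ j).2 i, hr0⟩ next r
  exact ⟨fun r => (seq r).1, fun r => (seq r).2.1, fun r f => hnext r (seq r) f, haug⟩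

/-- An endomorphism of a minimal resolution that lifts the identity is the identity modulo
`𝔪 = (x_a : a ∈ V)`, because it is homotopic to the identity and the differentials have entries
in `𝔪`. -/
theorem constantCoeff_lift_id (F : MinimalGradedFreeResolution I)
    (θ : ∀ r, (Fin (F.rank r) → MvPolynomial V K) →ₗ[MvPolynomial V K]
        (Fin (F.rank r) → MvPolynomial V K))
    (hθ : ∀ r f, F.diff r (θ (r + 1) f) = θ r (F.diff r f))
    (hθ₀ : ∀ f, F.aug (θ 0 f) = F.aug f) (r : ℕ) (f : Fin (F.rank r) → MvPolynomial V K)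
    (i : Fin (F.rank r)) : constantCoeff (θ r f i) = constantCoeff (f i) := by
  suffices H : ∀ r, (∃ h : (Fin (F.rank r) → MvPolynomial V K) →ₗ[MvPolynomial V K]
        (Fin (F.rank (r + 1)) → MvPolynomial V K),
      ∀ f, θ r (F.diff r f) - F.diff r f = F.diff r (h (F.diff r f))) ∧
      ∀ f i, constantCoeff (θ r f i) = constantCoeff (f i) from (H r).2 f i
  intro r
  induction r with
  | zero =>
    have h0 : ∀ j, ∃ y : Fin (F.rank 1) → MvPolynomial V K, F.diff 0 y = θ 0 (Pi.single j 1) - Pi.single j 1 := fun j => by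
      have := (F.exact_zero (θ 0 (Pi.single j 1) - Pi.single j 1)).1
        (by rw [map_sub, hθ₀, sub_self])
      exact this
    obtain ⟨h, hh⟩ := exists_linearMap_single (R := MvPolynomial V K) h0
    have hh' : F.diff 0 ∘ₗ h = θ 0 - LinearMap.id :=
      (Pi.basisFun _ _).ext fun j => by simpa using hh j
    have hh'' : ∀ f, θ 0 f - f = F.diff 0 (h f) := fun f => (LinearMap.congr_fun hh' f).symm
    refine ⟨⟨h, fun f => hh'' _⟩, fun f i => ?_⟩
    rw [← sub_eq_zero, ← map_sub, ← Pi.sub_apply, hh'']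
    exact constantCoeff_eq_zero_of_mem (F.minimal 0 _ i)
  | succ r ih =>
    obtain ⟨⟨h, hh⟩, -⟩ := ih
    have h0 : ∀ j, ∃ y : Fin (F.rank (r + 2)) → MvPolynomial V K, F.diff (r + 1) y = θ (r + 1) (Pi.single j 1) - Pi.single j 1 -
        h (F.diff r (Pi.single j 1)) := fun j => by
      have := (F.exact_succ r (θ (r + 1) (Pi.single j 1) - Pi.single j 1 -
        h (F.diff r (Pi.single j 1)))).1
        (by rw [map_sub, map_sub, hθ, hh, sub_self])
      exact this
    obtain ⟨h', hh'⟩ := exists_linearMap_single (R := MvPolynomial V K) h0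
    have h1 : F.diff (r + 1) ∘ₗ h' = θ (r + 1) - LinearMap.id - h ∘ₗ F.diff r :=
      (Pi.basisFun _ _).ext fun j => by simpa using hh' j
    have h2 : ∀ f, θ (r + 1) f - f - h (F.diff r f) = F.diff (r + 1) (h' f) :=
      fun f => (LinearMap.congr_fun h1 f).symm
    refine ⟨⟨h', fun f => ?_⟩, fun f i => ?_⟩
    · rw [← h2, F.diff_diff, map_zero, sub_zero]
    · have h3 : θ (r + 1) f - f = F.diff (r + 1) (h' f) + h (F.diff r f) := by
        rw [← h2, sub_add_cancel]
      rw [← sub_eq_zero, ← map_sub, ← Pi.sub_apply, h3, Pi.add_apply, map_add,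
        constantCoeff_eq_zero_of_mem (F.minimal _ _ i), zero_add, linearMap_apply_eq_sum h,
        Finset.sum_apply, map_sum]
      refine Finset.sum_eq_zero fun j _ => ?_
      rw [Pi.smul_apply, smul_eq_mul, map_mul, constantCoeff_eq_zero_of_mem (F.minimal _ _ j),
        zero_mul]

/-- The block of degree `d` of a comparison map is injective modulo `𝔪`, being left invertible. -/
theorem count_le_count (F G : MinimalGradedFreeResolution I)
    (hI : I.IsHomogeneous (homogeneousSubmodule V K)) (r d : ℤ) : F.count r d ≤ G.count r d := by
  unfold count
  split_ifs with hr
  swap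
  · exact le_rfl
  generalize r.toNat = s
  obtain ⟨φ, hφ, hφc, hφ₀⟩ := exists_chainMap F G hI inDegree_one (by simp)
  obtain ⟨ψ, hψ, hψc, hψ₀⟩ := exists_chainMap G F hI inDegree_one (by simp)
  have hθ := F.constantCoeff_lift_id (fun r => ψ r ∘ₗ φ r)
    (fun r f => by simp [hφc, hψc])
    (fun f => by
      obtain ⟨p, hp⟩ := Ideal.Quotient.mk_surjective (F.aug f)
      rw [LinearMap.comp_apply, hψ₀ _ (1 * p) (hφ₀ _ p hp.symm), one_mul, one_mul, hp]) s
  -- The blocks of degree `d` of the matrices of `φ` and `ψ` modulo `𝔪`.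
  let A : Matrix {l // G.deg s l = d} {j // F.deg s j = d} K :=
    fun l j => constantCoeff (φ s (Pi.single j.1 1) l.1)
  let B : Matrix {j // F.deg s j = d} {l // G.deg s l = d} K :=
    fun i l => constantCoeff (ψ s (Pi.single l.1 1) i.1)
  have hBA : B * A = 1 := by
    ext i j
    have h := hθ (Pi.single j.1 1) i.1
    rw [LinearMap.comp_apply, linearMap_apply_eq_sum (ψ s), Finset.sum_apply, map_sum] at h
    have h1 : constantCoeff ((Pi.single j.1 1 : Fin (F.rank s) → MvPolynomial V K) i.1) =
        (1 : Matrix {j // F.deg s j = d} {j // F.deg s j = d} K) i j := by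
      by_cases hij : i = j
      · subst hij; simp
      · rw [Matrix.one_apply_ne hij, Pi.single_eq_of_ne (fun h => hij (Subtype.ext h)), map_zero]
    rw [← h1, ← h, Matrix.mul_apply]
    have hzero : ∀ l, G.deg s l ≠ d → constantCoeff (φ s (Pi.single j.1 1) l) = 0 := by
      intro l hl
      by_contra h2
      have := (hφ s j.1 l).eq_zero_of_constantCoeff_ne_zero h2
      have := j.2
      omega
    rw [← Finset.sum_filter_add_sum_filter_not Finset.univ (fun l => G.deg s l = d),
      Finset.sum_eq_zero (s := Finset.univ.filter fun l => ¬ G.deg s l = d), add_zero,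
      ← Finset.sum_subtype_eq_sum_filter]
    · simp [A, B, mul_comm]
    · intro l hl
      simp [hzero l (Finset.mem_filter.1 hl).2]
  have h1 := Matrix.rank_mul_le_right B A
  rw [hBA, Matrix.rank_one] at h1
  simpa [Fintype.card_subtype] using h1.trans A.rank_le_card_height

/-- The graded Betti numbers of a homogeneous ideal can be read off from any minimal graded free
resolution. -/
theorem gradedBetti_eq_count (F : MinimalGradedFreeResolution I)
    (hI : I.IsHomogeneous (homogeneousSubmodule V K)) (r d : ℤ) :
    gradedBetti I r d = F.count r d := by
  unfold gradedBetti
  rw [dif_pos ⟨F⟩]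
  exact le_antisymm (count_le_count _ _ hI r d) (count_le_count _ _ hI r d)

end MinimalGradedFreeResolution

namespace MinimalGradedFreeResolution

variable {I J L : Ideal (MvPolynomial V K)}

/-! ### Mapping cones -/

/-- A minimal graded free resolution whose free modules have bases indexed by arbitrary finite
types `ι r`, rewritten with bases indexed by `Fin`. -/
theorem exists_of_fintype (ι : ℕ → Type) [∀ r, Fintype (ι r)] [∀ r, DecidableEq (ι r)]
    (deg : ∀ r, ι r → ℤ)
    (diff : ∀ r, (ι (r + 1) → MvPolynomial V K) →ₗ[MvPolynomial V K] (ι r → MvPolynomial V K))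
    (aug : (ι 0 → MvPolynomial V K) →ₗ[MvPolynomial V K] (MvPolynomial V K ⧸ I))
    (diff_homogeneous : ∀ r, HomogeneousMap 0 (deg (r + 1)) (deg r) (diff r))
    (aug_homogeneous : ∀ i, ∃ p, InDegree p (deg 0 i) ∧
      aug (Pi.single i 1) = Ideal.Quotient.mk I p)
    (aug_surjective : Function.Surjective aug)
    (exact_zero : Function.Exact (diff 0) aug)
    (exact_succ : ∀ r, Function.Exact (diff (r + 1)) (diff r))
    (minimal : ∀ r j i, diff r (Pi.single j 1) i ∈
      Ideal.span (Set.range (X : V → MvPolynomial V K))) :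
    ∃ F : MinimalGradedFreeResolution I, ∀ r d : ℤ, F.count r d =
      if 0 ≤ r then (Finset.univ.filter fun i => deg r.toNat i = d).card else 0 := by
  let e : ∀ r, ι r ≃ Fin (Fintype.card (ι r)) := fun r => Fintype.equivFin (ι r)
  let E : ∀ r, (Fin (Fintype.card (ι r)) → MvPolynomial V K) ≃ₗ[MvPolynomial V K]
      (ι r → MvPolynomial V K) := fun r => LinearEquiv.funCongrLeft _ _ (e r)
  have hE : ∀ r j, E r (Pi.single j 1) = Pi.single ((e r).symm j) 1 := by
    intro r j
    ext1 i
    simp [E, LinearEquiv.funCongrLeft_apply, LinearMap.funLeft_apply, Pi.single_apply,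
      Equiv.eq_symm_apply]
  have hE' : ∀ r (y : ι r → MvPolynomial V K) i, (E r).symm y i = y ((e r).symm i) := by
    intro r y i
    rfl
  have hmin : ∀ r f i, diff r f i ∈ Ideal.span (Set.range (X : V → MvPolynomial V K)) := by
    intro r f i
    rw [linearMap_apply_eq_sum, Finset.sum_apply]
    exact Ideal.sum_mem _ fun j _ => Ideal.mul_mem_left _ _ (minimal r j i)
  refine ⟨{
    rank := fun r => Fintype.card (ι r)
    deg := fun r i => deg r ((e r).symm i)
    diff := fun r => (E r).symm.toLinearMap ∘ₗ diff r ∘ₗ (E (r + 1)).toLinearMap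
    aug := aug ∘ₗ (E 0).toLinearMap
    diff_homogeneous := fun r j i => ?_
    aug_homogeneous := fun i => ?_
    aug_surjective := aug_surjective.comp (E 0).surjective
    exact_zero := fun y => ?_
    exact_succ := fun r y => ?_
    minimal := fun r f i => ?_ }, fun r d => ?_⟩
  · have := diff_homogeneous r ((e (r + 1)).symm j) ((e r).symm i)
    simpa [hE, hE'] using this
  · simpa [hE] using aug_homogeneous ((e 0).symm i)
  · have := exact_zero (E 0 y)
    simp only [LinearMap.comp_apply, LinearEquiv.coe_coe, this, Set.mem_range,
      LinearEquiv.symm_apply_eq]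
    exact ((E 1).surjective.exists (p := fun x => diff 0 x = E 0 y))
  · have := exact_succ r (E (r + 1) y)
    simp only [LinearMap.comp_apply, LinearEquiv.coe_coe, LinearEquiv.map_eq_zero_iff, this,
      Set.mem_range, LinearEquiv.symm_apply_eq]
    exact ((E (r + 2)).surjective.exists (p := fun x => diff (r + 1) x = E (r + 1) y))
  · exact hmin _ _ _
  · unfold count
    split_ifs with h
    · dsimp only
      exact Finset.card_equiv (e r.toNat).symm (by simp)
    · rfl

/-- The sequence of types `ι₀, ι 0, ι 1, …`. -/
def consType (ι₀ : Type) (ι : ℕ → Type) : ℕ → Type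
  | 0 => ι₀
  | r + 1 => ι r

/-- The variant of `exists_of_fintype` in which the basis `ι₀` of the module of homological degree
`0` is given separately, and `ι r` is the basis of the module of homological degree `r + 1`. -/
theorem exists_of_fintype_succ (ι₀ : Type) [Fintype ι₀] [DecidableEq ι₀] (ι : ℕ → Type)
    [∀ r, Fintype (ι r)] [∀ r, DecidableEq (ι r)] (deg₀ : ι₀ → ℤ) (deg : ∀ r, ι r → ℤ)
    (diff₀ : (ι 0 → MvPolynomial V K) →ₗ[MvPolynomial V K] (ι₀ → MvPolynomial V K))
    (diff : ∀ r, (ι (r + 1) → MvPolynomial V K) →ₗ[MvPolynomial V K] (ι r → MvPolynomial V K))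
    (aug : (ι₀ → MvPolynomial V K) →ₗ[MvPolynomial V K] (MvPolynomial V K ⧸ I))
    (diff₀_homogeneous : HomogeneousMap 0 (deg 0) deg₀ diff₀)
    (diff_homogeneous : ∀ r, HomogeneousMap 0 (deg (r + 1)) (deg r) (diff r))
    (aug_homogeneous : ∀ i, ∃ p, InDegree p (deg₀ i) ∧
      aug (Pi.single i 1) = Ideal.Quotient.mk I p)
    (aug_surjective : Function.Surjective aug)
    (exact_zero : Function.Exact diff₀ aug)
    (exact_one : Function.Exact (diff 0) diff₀)
    (exact_succ : ∀ r, Function.Exact (diff (r + 1)) (diff r))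
    (minimal₀ : ∀ j i, diff₀ (Pi.single j 1) i ∈
      Ideal.span (Set.range (X : V → MvPolynomial V K)))
    (minimal : ∀ r j i, diff r (Pi.single j 1) i ∈
      Ideal.span (Set.range (X : V → MvPolynomial V K))) :
    ∃ F : MinimalGradedFreeResolution I,
      (∀ d : ℤ, F.count 0 d = (Finset.univ.filter fun i => deg₀ i = d).card) ∧
      ∀ (r : ℕ) (d : ℤ), F.count (r + 1) d = (Finset.univ.filter fun i => deg r i = d).card := by
  let i1 : ∀ r, Fintype (consType ι₀ ι r) := fun r => match r with
    | 0 => (inferInstance : Fintype ι₀)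
    | r + 1 => (inferInstance : Fintype (ι r))
  let i2 : ∀ r, DecidableEq (consType ι₀ ι r) := fun r => match r with
    | 0 => (inferInstance : DecidableEq ι₀)
    | r + 1 => (inferInstance : DecidableEq (ι r))
  let deg' : ∀ r, consType ι₀ ι r → ℤ := fun r => match r with
    | 0 => deg₀
    | r + 1 => deg r
  let diff' : ∀ r : ℕ, (consType ι₀ ι (r + 1) → MvPolynomial V K) →ₗ[MvPolynomial V K]
      (consType ι₀ ι r → MvPolynomial V K) := by
    rintro (_ | r)
    exacts [diff₀, diff r]
  obtain ⟨F, hF⟩ := exists_of_fintype (I := I) (consType ι₀ ι) deg' diff' aug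
    (fun r => match r with
      | 0 => diff₀_homogeneous
      | r + 1 => diff_homogeneous r) aug_homogeneous aug_surjective exact_zero
    (fun r => match r with
      | 0 => exact_one
      | r + 1 => exact_succ r)
    (fun r => match r with
      | 0 => minimal₀
      | r + 1 => minimal r)
  refine ⟨F, fun d => hF 0 d, fun r d => ?_⟩
  rw [hF, if_pos (by omega)]
  have : ((r : ℤ) + 1).toNat = r + 1 := by omega
  rw [this]
  rfl

/-- The homomorphism out of a direct sum with the given restrictions to the summands. -/
noncomputable def sumMap {a b M : Type*} {R : Type*} [CommRing R] [AddCommGroup M] [Module R M]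
    (A : (a → R) →ₗ[R] M) (B : (b → R) →ₗ[R] M) : (a ⊕ b → R) →ₗ[R] M :=
  A ∘ₗ LinearMap.funLeft R R Sum.inl + B ∘ₗ LinearMap.funLeft R R Sum.inr

section

variable {a b c d M R : Type*} [CommRing R] [AddCommGroup M] [Module R M]

@[simp] theorem sumMap_elim (A : (a → R) →ₗ[R] M) (B : (b → R) →ₗ[R] M) (f : a → R) (g : b → R) :
    sumMap A B (Sum.elim f g) = A f + B g := rfl

@[simp] theorem sumMap_single_inl [DecidableEq a] [DecidableEq b] (A : (a → R) →ₗ[R] M)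
    (B : (b → R) →ₗ[R] M) (i : a) (x : R) :
    sumMap A B (Pi.single (Sum.inl i) x) = A (Pi.single i x) := by
  rw [← Sum.elim_single_zero, sumMap_elim, map_zero, add_zero]

@[simp] theorem sumMap_single_inr [DecidableEq a] [DecidableEq b] (A : (a → R) →ₗ[R] M)
    (B : (b → R) →ₗ[R] M) (i : b) (x : R) :
    sumMap A B (Pi.single (Sum.inr i) x) = B (Pi.single i x) := by
  rw [← Sum.elim_zero_single, sumMap_elim, map_zero, zero_add]

/-- The homomorphism into a direct sum with the given components. -/
noncomputable def intoSum (A : M →ₗ[R] (c → R)) (B : M →ₗ[R] (d → R)) : M →ₗ[R] (c ⊕ d → R) :=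
  (LinearEquiv.sumArrowLequivProdArrow c d R R).symm.toLinearMap ∘ₗ A.prod B

@[simp] theorem intoSum_apply (A : M →ₗ[R] (c → R)) (B : M →ₗ[R] (d → R)) (x : M) :
    intoSum A B x = Sum.elim (A x) (B x) := rfl

theorem sumElim_eq_zero_iff {f : a → R} {g : b → R} : Sum.elim f g = 0 ↔ f = 0 ∧ g = 0 := by
  rw [← Sum.elim_zero_zero]
  exact Sum.elim_eq_iff

end

/-- Let `q` be homogeneous of degree `k` and `x` a variable, and let `L = J : (x q)` be such that
even `q L ⊆ J`. The mapping cone of a lift of `x q : R ⧸ L ⟶ R ⧸ J` to minimal resolutions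
resolves `R ⧸ (J + (x q))`, as `x q` is injective with this cokernel. It is minimal, since the lift
can be taken to be `x` times a lift of `q`. -/
theorem exists_cone (F : MinimalGradedFreeResolution J) (G : MinimalGradedFreeResolution L)
    (hJ : J.IsHomogeneous (homogeneousSubmodule V K)) (x : V) {q : MvPolynomial V K} {k : ℤ}
    (hq : InDegree q k) (hqL : ∀ p ∈ L, q * p ∈ J) (hL : ∀ p, X x * q * p ∈ J → p ∈ L)
    (hI : I = J ⊔ Ideal.span {X x * q}) :
    ∃ H : MinimalGradedFreeResolution I,
      ∀ r d : ℤ, H.count r d = F.count r d + G.count (r - 1) (d - (k + 1)) := by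
  obtain ⟨φ, hφ, hφc, hφ₀⟩ := exists_chainMap G F hJ hq hqL
  let ψ : ∀ r, (Fin (G.rank r) → MvPolynomial V K) →ₗ[MvPolynomial V K]
      (Fin (F.rank r) → MvPolynomial V K) := fun r => (X x : MvPolynomial V K) • φ r
  have hψc : ∀ r f, F.diff r (ψ (r + 1) f) = ψ r (G.diff r f) := fun r f => by
    simp [ψ, hφc]
  have hψ₀ : ∀ f p, G.aug f = Ideal.Quotient.mk L p →
      F.aug (ψ 0 f) = Ideal.Quotient.mk J (X x * q * p) := fun f p hp => by
    simp only [ψ, LinearMap.smul_apply, map_smul, hφ₀ f p hp, mul_assoc]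
    rfl
  have hψ : ∀ r, HomogeneousMap (k + 1) (G.deg r) (F.deg r) (ψ r) := fun r j i => by
    have := (inDegree_X (K := K) x).mul (hφ r j i)
    simp only [ψ, LinearMap.smul_apply, Pi.smul_apply, smul_eq_mul]
    convert this using 1
    ring
  have hJI : J ≤ I := hI ▸ le_sup_left
  let aug : (Fin (F.rank 0) → MvPolynomial V K) →ₗ[MvPolynomial V K] (MvPolynomial V K ⧸ I) :=
    (Ideal.Quotient.factorₐ (MvPolynomial V K) hJI).toLinearMap ∘ₗ F.aug
  have haug : ∀ f p, F.aug f = Ideal.Quotient.mk J p → aug f = Ideal.Quotient.mk I p := by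
    intro f p hp
    simp only [aug, LinearMap.comp_apply, hp]
    rfl
  let D₀ := sumMap (F.diff 0) (ψ 0)
  let D := fun r => intoSum (sumMap (F.diff (r + 1)) (ψ (r + 1))) (sumMap 0 (-G.diff r))
  have hmin : ∀ r j i, F.diff r j i ∈ Ideal.span (Set.range (X : V → MvPolynomial V K)) := F.minimal
  have hminψ : ∀ r j i, ψ r j i ∈ Ideal.span (Set.range (X : V → MvPolynomial V K)) :=
    fun r j i => Ideal.mul_mem_right _ _ (Ideal.subset_span ⟨x, rfl⟩)
  obtain ⟨H, hH₀, hH⟩ := exists_of_fintype_succ (I := I) (Fin (F.rank 0))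
    (fun r => Fin (F.rank (r + 1)) ⊕ Fin (G.rank r)) (F.deg 0)
    (fun r => Sum.elim (F.deg (r + 1)) fun i => G.deg r i + (k + 1)) D₀ D aug
    (by
      rintro (j | j) i
      · simpa [D₀] using F.diff_homogeneous 0 j i
      · simpa [D₀] using hψ 0 j i)
    (by
      rintro r (j | j) (i | i)
      · simpa [D] using F.diff_homogeneous (r + 1) j i
      · simpa [D] using InDegree.zero _
      · simpa [D] using hψ (r + 1) j i
      · simpa [D] using (G.diff_homogeneous r j i).neg)
    (fun i => by
      obtain ⟨p, hp, hp'⟩ := F.aug_homogeneous i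
      exact ⟨p, hp, haug _ _ hp'⟩)
    ((Ideal.Quotient.factor_surjective hJI).comp F.aug_surjective)
    (by
      intro f
      constructor
      · intro hf
        obtain ⟨p, hp⟩ := Ideal.Quotient.mk_surjective (F.aug f)
        rw [haug f p hp.symm, Ideal.Quotient.eq_zero_iff_mem, hI] at hf
        obtain ⟨p₁, hp₁, p₂, hp₂, hpp⟩ := Submodule.mem_sup.1 hf
        obtain ⟨s, rfl⟩ := Ideal.mem_span_singleton'.1 hp₂
        obtain ⟨b, hb⟩ := G.aug_surjective (Ideal.Quotient.mk L s)
        have : F.aug (f - ψ 0 b) = 0 := by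
          rw [map_sub, ← hp, hψ₀ b s hb, ← map_sub, Ideal.Quotient.eq_zero_iff_mem, ← hpp]
          convert hp₁ using 1
          ring
        obtain ⟨c, hc⟩ := (F.exact_zero _).1 this
        exact ⟨Sum.elim c b, by simp [D₀, hc]⟩
      · rintro ⟨g, rfl⟩
        obtain ⟨a, b, rfl⟩ : ∃ a b, g = Sum.elim a b :=
          ⟨g ∘ Sum.inl, g ∘ Sum.inr, (Sum.elim_comp_inl_inr g).symm⟩
        obtain ⟨s, hs⟩ := Ideal.Quotient.mk_surjective (G.aug b)
        rw [haug _ (X x * q * s) (by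
          simp only [D₀, sumMap_elim, map_add, F.aug_diff, hψ₀ b s hs.symm, zero_add]),
          Ideal.Quotient.eq_zero_iff_mem, hI]
        exact Ideal.mem_sup_right (Ideal.mul_mem_right _ _ (Ideal.subset_span rfl)))
    (by
      intro g
      obtain ⟨a, b, rfl⟩ : ∃ a b, g = Sum.elim a b :=
        ⟨g ∘ Sum.inl, g ∘ Sum.inr, (Sum.elim_comp_inl_inr g).symm⟩
      simp only [D₀, sumMap_elim]
      constructor
      · intro hab
        obtain ⟨s, hs⟩ := Ideal.Quotient.mk_surjective (G.aug b)
        have h1 := congrArg F.aug hab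
        rw [map_add, F.aug_diff, zero_add, hψ₀ b s hs.symm, map_zero,
          Ideal.Quotient.eq_zero_iff_mem] at h1
        have h2 : G.aug b = 0 := by
          rw [← hs, Ideal.Quotient.eq_zero_iff_mem]
          exact hL s h1
        obtain ⟨c, rfl⟩ := (G.exact_zero b).1 h2
        rw [← hψc, ← map_add] at hab
        obtain ⟨e, he⟩ := (F.exact_succ 0 _).1 hab
        refine ⟨Sum.elim e (-c), ?_⟩
        simp [D, he]
      · rintro ⟨h, hh⟩
        obtain ⟨e, c, rfl⟩ : ∃ e c, h = Sum.elim e c :=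
          ⟨h ∘ Sum.inl, h ∘ Sum.inr, (Sum.elim_comp_inl_inr h).symm⟩
        simp only [D, intoSum_apply, sumMap_elim] at hh
        obtain ⟨rfl, rfl⟩ := Sum.elim_eq_iff.1 hh
        simp [F.diff_diff, hψc])
    (by
      intro r g
      obtain ⟨a, b, rfl⟩ : ∃ a b, g = Sum.elim a b :=
        ⟨g ∘ Sum.inl, g ∘ Sum.inr, (Sum.elim_comp_inl_inr g).symm⟩
      simp only [D, sumMap_elim, intoSum_apply, sumElim_eq_zero_iff, LinearMap.zero_apply,
        LinearMap.neg_apply, zero_add, neg_eq_zero]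
      constructor
      · rintro ⟨hab, hb⟩
        obtain ⟨c, rfl⟩ := (G.exact_succ r b).1 hb
        rw [← hψc, ← map_add] at hab
        obtain ⟨e, he⟩ := (F.exact_succ (r + 1) _).1 hab
        refine ⟨Sum.elim e (-c), ?_⟩
        simp [he]
      · rintro ⟨h, hh⟩
        obtain ⟨e, c, rfl⟩ : ∃ e c, h = Sum.elim e c :=
          ⟨h ∘ Sum.inl, h ∘ Sum.inr, (Sum.elim_comp_inl_inr h).symm⟩
        simp only [intoSum_apply, sumMap_elim] at hh
        obtain ⟨rfl, rfl⟩ := Sum.elim_eq_iff.1 hh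
        simp [F.diff_diff, G.diff_diff, hψc])
    (by
      rintro (j | j) i
      · simpa [D₀] using hmin 0 _ i
      · simpa [D₀] using hminψ 0 _ i)
    (by
      rintro r (j | j) (i | i)
      · simpa [D] using hmin (r + 1) _ i
      · simp [D]
      · simpa [D] using hminψ (r + 1) _ i
      · simpa [D] using G.minimal r _ i)
  refine ⟨H, fun r d => ?_⟩
  rcases lt_or_ge r 0 with hr | hr
  · simp [count, not_le.2 hr, show ¬ 1 ≤ r by omega]
  lift r to ℕ using hr
  cases r with
  | zero =>
    rw [Nat.cast_zero, hH₀]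
    simp [count]
  | succ r =>
    push_cast
    rw [hH, add_sub_cancel_right]
    have h1 : ((r : ℤ) + 1).toNat = r + 1 := by omega
    rw [count, count, if_pos (by omega), if_pos (by omega), h1, Int.toNat_natCast]
    simp only [Finset.card_filter, Fintype.sum_sum_type, Sum.elim_inl, Sum.elim_inr,
      eq_sub_iff_add_eq]
    congr!

end MinimalGradedFreeResolution

/-! ### Projective dimension -/

section

universe w

open CategoryTheory

theorem hasProjectiveDimensionLT_add_two_iff {R P M : Type w} [CommRing R] [AddCommGroup P]
    [Module R P] [AddCommGroup M] [Module R M] [Module.Projective R P] (π : P →ₗ[R] M)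
    (hπ : Function.Surjective π) (n : ℕ) :
    HasProjectiveDimensionLT (ModuleCat.of R M) (n + 2) ↔
      HasProjectiveDimensionLT (ModuleCat.of R (LinearMap.ker π)) (n + 1) := by
  let S : ShortComplex (ModuleCat.{w} R) :=
    ShortComplex.mk (ModuleCat.ofHom (LinearMap.ker π).subtype) (ModuleCat.ofHom π) (by
      ext x
      exact x.2)
  have hS : S.ShortExact := {
    exact := by
      rw [ShortComplex.ShortExact.moduleCat_exact_iff_function_exact]
      intro x
      change π x = 0 ↔ x ∈ Set.range (LinearMap.ker π).subtype
      simp only [Submodule.coe_subtype, Subtype.range_coe_subtype]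
      rfl
    mono_f := (ModuleCat.mono_iff_injective _).2 Subtype.val_injective
    epi_g := (ModuleCat.epi_iff_surjective _).2 hπ }
  exact hS.hasProjectiveDimensionLT_X₃_iff n
    (inferInstanceAs (Projective (ModuleCat.of R P)))

end

/-- A cover of a projective module by a free module with relations in `𝔪 = (x_a : a ∈ V)` is an
isomorphism: the relations `N` are a direct summand, so `N = 𝔪 N`, hence `N` is annihilated
by an element of `1 + 𝔪`, which is a nonzerodivisor. -/
theorem projective_iff_ker_eq_bot {m M : Type*} [Fintype m] [DecidableEq m] [AddCommGroup M]
    [Module (MvPolynomial V K) M] (π : (m → MvPolynomial V K) →ₗ[MvPolynomial V K] M)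
    (hπ : Function.Surjective π)
    (hker : ∀ f, π f = 0 → ∀ i, f i ∈ Ideal.span (Set.range (X : V → MvPolynomial V K))) :
    Module.Projective (MvPolynomial V K) M ↔ LinearMap.ker π = ⊥ := by
  refine ⟨fun h => ?_, fun h => Module.Projective.of_equiv
    (LinearEquiv.ofBijective π ⟨LinearMap.ker_eq_bot.1 h, hπ⟩)⟩
  obtain ⟨s, hs⟩ := Module.projective_lifting_property π LinearMap.id hπ
  let ρ : (m → MvPolynomial V K) →ₗ[MvPolynomial V K] (m → MvPolynomial V K) :=
    LinearMap.id - s ∘ₗ π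
  have hρ : ∀ f, π f = 0 → ρ f = f := fun f hf => by simp [ρ, hf]
  have hπρ : ∀ f, π (ρ f) = 0 := fun f => by
    have := LinearMap.congr_fun hs (π f)
    simp only [LinearMap.comp_apply, LinearMap.id_apply] at this
    simp [ρ, this]
  have hrange : LinearMap.ker π = LinearMap.range ρ := le_antisymm
    (fun f hf => ⟨f, hρ f hf⟩) (by rintro _ ⟨f, rfl⟩; exact hπρ f)
  have hfg : (LinearMap.ker π).FG := by
    rw [hrange]
    rw [LinearMap.range_eq_map]
    exact Module.Finite.fg_top.map ρ
  obtain ⟨r, hr, hr'⟩ := Submodule.exists_sub_one_mem_and_smul_eq_zero_of_fg_of_le_smul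
    (Ideal.span (Set.range (X : V → MvPolynomial V K))) (LinearMap.ker π) hfg (fun f hf => by
      rw [← hρ f hf, linearMap_apply_eq_sum ρ]
      exact Submodule.sum_mem _ fun j _ => Submodule.smul_mem_smul (hker f hf j) (hπρ _))
  have hr0 : r ≠ 0 := by
    rintro rfl
    simpa using constantCoeff_eq_zero_of_mem hr
  rw [eq_bot_iff]
  intro f hf
  ext1 i
  have := congrFun (hr' f hf) i
  simpa [hr0] using this

namespace MinimalGradedFreeResolution

variable {I : Ideal (MvPolynomial V K)}

open CategoryTheory

theorem range_diff_eq_bot_iff (F : MinimalGradedFreeResolution I) (r : ℕ) :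
    LinearMap.range (F.diff r) = ⊥ ↔ F.rank (r + 1) = 0 := by
  constructor
  · intro h
    rw [LinearMap.range_eq_bot] at h
    by_contra hr
    let i : Fin (F.rank (r + 1)) := ⟨0, Nat.pos_of_ne_zero hr⟩
    obtain ⟨y, hy⟩ := (F.exact_succ r (Pi.single i 1)).1 (by rw [h]; rfl)
    have := constantCoeff_eq_zero_of_mem (F.minimal (r + 1) y i)
    rw [hy] at this
    simp at this
  · intro h
    have : IsEmpty (Fin (F.rank (r + 1))) := by rw [h]; infer_instance
    rw [LinearMap.range_eq_bot]
    exact Subsingleton.elim _ _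

theorem subsingleton_iff_rank_zero (F : MinimalGradedFreeResolution I) :
    Subsingleton (MvPolynomial V K ⧸ I) ↔ F.rank 0 = 0 := by
  constructor
  · intro h
    by_contra hr
    let i : Fin (F.rank 0) := ⟨0, Nat.pos_of_ne_zero hr⟩
    obtain ⟨y, hy⟩ := (F.exact_zero (Pi.single i 1)).1 (Subsingleton.elim _ _)
    have := constantCoeff_eq_zero_of_mem (F.minimal 0 y i)
    rw [hy] at this
    simp at this
  · intro h
    have : IsEmpty (Fin (F.rank 0)) := by rw [h]; infer_instance
    exact F.aug_surjective.subsingleton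

theorem ker_aug (F : MinimalGradedFreeResolution I) :
    LinearMap.ker F.aug = LinearMap.range (F.diff 0) :=
  LinearMap.exact_iff.1 F.exact_zero

theorem ker_rangeRestrict (F : MinimalGradedFreeResolution I) (r : ℕ) :
    LinearMap.ker (F.diff r).rangeRestrict = LinearMap.range (F.diff (r + 1)) := by
  rw [LinearMap.ker_rangeRestrict]
  exact LinearMap.exact_iff.1 (F.exact_succ r)

/-- The projective dimension of a syzygy module, by dimension shifting. The module
`range (F.diff r)` is covered by `F_{r+1}` with kernel `range (F.diff (r + 1))`. -/
theorem hasProjectiveDimensionLT_range_iff (F : MinimalGradedFreeResolution I) (r n : ℕ) :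
    HasProjectiveDimensionLT (ModuleCat.of (MvPolynomial V K) (LinearMap.range (F.diff r)))
      (n + 1) ↔ F.rank (r + n + 2) = 0 := by
  induction n generalizing r with
  | zero =>
    rw [zero_add, ← projective_iff_hasProjectiveDimensionLT_one, ← IsProjective.iff_projective,
      projective_iff_ker_eq_bot _ (F.diff r).surjective_rangeRestrict, F.ker_rangeRestrict,
      range_diff_eq_bot_iff, add_zero]
    intro f hf
    have h : f ∈ LinearMap.ker (F.diff r).rangeRestrict := hf
    rw [F.ker_rangeRestrict] at h
    obtain ⟨y, rfl⟩ := h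
    exact F.minimal (r + 1) y
  | succ n ih =>
    rw [hasProjectiveDimensionLT_add_two_iff _ (F.diff r).surjective_rangeRestrict,
      F.ker_rangeRestrict, ih, show r + 1 + n + 2 = r + (n + 1) + 2 by ring]

/-- The projective dimension of `R ⧸ I` is the length of a minimal resolution. In particular, once one
of the modules of a minimal resolution vanishes, so do all later ones. -/
theorem hasProjectiveDimensionLT_iff (F : MinimalGradedFreeResolution I) (n : ℕ) :
    HasProjectiveDimensionLT (ModuleCat.of (MvPolynomial V K) (MvPolynomial V K ⧸ I)) n ↔
      F.rank n = 0 := by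
  match n with
  | 0 =>
    rw [hasProjectiveDimensionLT_zero_iff_isZero, ModuleCat.isZero_iff_subsingleton,
      ← F.subsingleton_iff_rank_zero]
  | 1 =>
    rw [← projective_iff_hasProjectiveDimensionLT_one, ← IsProjective.iff_projective,
      projective_iff_ker_eq_bot _ F.aug_surjective, F.ker_aug, range_diff_eq_bot_iff]
    intro f hf
    obtain ⟨y, rfl⟩ := (F.exact_zero f).1 hf
    exact F.minimal 0 y
  | n + 2 =>
    rw [hasProjectiveDimensionLT_add_two_iff _ F.aug_surjective, F.ker_aug,
      F.hasProjectiveDimensionLT_range_iff, zero_add]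

theorem rank_eq_zero_iff (F : MinimalGradedFreeResolution I) (n : ℕ) :
    F.rank n = 0 ↔ ∀ d : ℤ, F.count n d = 0 := by
  simp only [count, Int.natCast_nonneg, if_true, Int.toNat_natCast, Finset.card_eq_zero,
    Finset.filter_eq_empty_iff, Finset.mem_univ, true_imp_iff]
  constructor
  · intro h d i
    rw [h] at i
    exact i.elim0
  · intro h
    by_contra hn
    exact h _ (x := ⟨0, Nat.pos_of_ne_zero hn⟩) rfl

theorem pd_lt_iff (F : MinimalGradedFreeResolution I)
    (hI : I.IsHomogeneous (homogeneousSubmodule V K)) (n : ℕ) :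
    pd I < n ↔ ∀ d : ℤ, gradedBetti I n d = 0 := by
  simp only [F.gradedBetti_eq_count hI, ← F.rank_eq_zero_iff]
  rw [← F.hasProjectiveDimensionLT_iff]
  exact projectiveDimension_lt_iff

end MinimalGradedFreeResolution

/-! ### Squarefree monomial ideals -/

theorem sup_span_X_eq_span_monomial (G : SimpleGraph V) (S : Set V) :
    edgeIdeal K G ⊔ Ideal.span (X '' S) = Ideal.span ((fun s => monomial s (1 : K)) ''
      ({s | ∃ a b, G.Adj a b ∧ s = Finsupp.single a 1 + Finsupp.single b 1} ∪
        {s | ∃ a ∈ S, s = Finsupp.single a 1})) := by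
  rw [edgeIdeal, ← Ideal.span_union, Set.image_union]
  congr 2
  · ext p
    constructor
    · rintro ⟨a, b, h, rfl⟩
      exact ⟨_, ⟨a, b, h, rfl⟩, by simp [X, monomial_mul]⟩
    · rintro ⟨_, ⟨a, b, h, rfl⟩, rfl⟩
      exact ⟨a, b, h, by simp [X, monomial_mul]⟩
  · ext p
    constructor
    · rintro ⟨a, h, rfl⟩
      exact ⟨_, ⟨a, h, rfl⟩, rfl⟩
    · rintro ⟨_, ⟨a, h, rfl⟩, rfl⟩
      exact ⟨a, h, rfl⟩

/-- A polynomial belongs to a sum of an edge ideal and an ideal of variables if and only if the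
support of each of its monomials contains an edge or one of the variables. -/
theorem mem_edgeIdeal_sup_iff (G : SimpleGraph V) (S : Set V) (p : MvPolynomial V K) :
    p ∈ edgeIdeal K G ⊔ Ideal.span (X '' S) ↔ ∀ e ∈ p.support,
      (∃ a b, G.Adj a b ∧ e a ≠ 0 ∧ e b ≠ 0) ∨ ∃ a ∈ S, e a ≠ 0 := by
  classical
  rw [sup_span_X_eq_span_monomial, mem_ideal_span_monomial_image]
  refine forall₂_congr fun e _ => ?_
  constructor
  · rintro ⟨s, ⟨a, b, h, rfl⟩ | ⟨a, h, rfl⟩, hs⟩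
    · refine Or.inl ⟨a, b, h, ?_, ?_⟩
      · have := hs a
        simp at this
        omega
      · have := hs b
        simp at this
        omega
    · refine Or.inr ⟨a, h, ?_⟩
      have := hs a
      simp at this
      omega
  · rintro (⟨a, b, h, ha, hb⟩ | ⟨a, h, ha⟩)
    · refine ⟨_, Or.inl ⟨a, b, h, rfl⟩, fun c => ?_⟩
      have hab := h.ne
      simp only [Finsupp.add_apply, Finsupp.single_apply]
      split_ifs with h1 h2 h2
      · exact absurd (h1.trans h2.symm) hab
      · subst h1; omega
      · subst h2; omega
      · omega
    · refine ⟨_, Or.inr ⟨a, h, rfl⟩, fun c => ?_⟩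
      simp only [Finsupp.single_apply]
      split_ifs with h1
      · subst h1; omega
      · omega

theorem mem_edgeIdeal_iff (G : SimpleGraph V) (p : MvPolynomial V K) :
    p ∈ edgeIdeal K G ↔ ∀ e ∈ p.support, ∃ a b, G.Adj a b ∧ e a ≠ 0 ∧ e b ≠ 0 := by
  simpa using mem_edgeIdeal_sup_iff (K := K) G ∅ p

theorem isHomogeneous_edgeIdeal_sup (G : SimpleGraph V) (S : Set V) :
    (edgeIdeal K G ⊔ Ideal.span (X '' S)).IsHomogeneous (homogeneousSubmodule V K) := by
  refine Ideal.IsHomogeneous.sup (Ideal.homogeneous_span _ _ ?_) (Ideal.homogeneous_span _ _ ?_)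
  · rintro _ ⟨a, b, -, rfl⟩
    exact ⟨2, (isHomogeneous_X K a).mul (isHomogeneous_X K b)⟩
  · rintro _ ⟨a, -, rfl⟩
    exact ⟨1, isHomogeneous_X K a⟩

theorem isHomogeneous_edgeIdeal (G : SimpleGraph V) :
    (edgeIdeal K G).IsHomogeneous (homogeneousSubmodule V K) := by
  simpa using isHomogeneous_edgeIdeal_sup (K := K) G ∅

theorem mem_support_X_mul {p : MvPolynomial V K} {e : V →₀ ℕ} (he : e ∈ p.support) (x : V) :
    Finsupp.single x 1 + e ∈ (X x * p).support := by
  rw [mem_support_iff, coeff_X_mul]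
  exact mem_support_iff.1 he

theorem eliminate_adj {G : SimpleGraph V} {S : Set V} {a b : V} :
    (eliminate G S).Adj a b ↔ G.Adj a b ∧ a ∉ S ∧ b ∉ S := by
  simp [eliminate]
  tauto

theorem eliminate_le (G : SimpleGraph V) (S : Set V) : eliminate G S ≤ G :=
  fun _ _ h => (eliminate_adj.1 h).1

/-! ### Deleting a leaf -/

section Leaf

variable {G : SimpleGraph V} {x y : V}

theorem edgeIdeal_eq_sup_of_leaf (hxy : G.Adj x y) (hx : ∀ z, G.Adj x z → z = y) :
    edgeIdeal K G = edgeIdeal K (eliminate G {x}) ⊔ Ideal.span {X x * X y} := by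
  apply le_antisymm
  · rw [edgeIdeal, Ideal.span_le]
    rintro _ ⟨a, b, hab, rfl⟩
    by_cases ha : a = x
    · subst ha
      rw [hx b hab]
      exact Ideal.mem_sup_right (Ideal.subset_span rfl)
    by_cases hb : b = x
    · subst hb
      rw [hx a hab.symm, mul_comm]
      exact Ideal.mem_sup_right (Ideal.subset_span rfl)
    exact Ideal.mem_sup_left (Ideal.subset_span ⟨a, b, eliminate_adj.2 ⟨hab, ha, hb⟩, rfl⟩)
  · rw [sup_le_iff]
    constructor
    · refine Ideal.span_mono ?_
      rintro _ ⟨a, b, hab, rfl⟩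
      exact ⟨a, b, eliminate_le _ _ hab, rfl⟩
    · rw [Ideal.span_singleton_le_iff_mem]
      exact Ideal.subset_span ⟨x, y, hxy, rfl⟩

/-- The colon ideal `I(G \ x) : x y` of a leaf `x` with neighbour `y` is carried into `I(G \ x)` by
`y` alone. -/
theorem X_mul_mem_of_mem_colon {p : MvPolynomial V K}
    (hp : p ∈ edgeIdeal K (eliminate G (insert y (G.neighborSet y))) ⊔
      Ideal.span (X '' {z | G.Adj y z ∧ z ≠ x})) (hxy : G.Adj x y) :
    X y * p ∈ edgeIdeal K (eliminate G {x}) := by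
  have h : Ideal.span (X '' {z | G.Adj y z ∧ z ≠ x}) ≤
      Submodule.comap (LinearMap.mulLeft (MvPolynomial V K) (X y))
        (edgeIdeal K (eliminate G {x})) := by
    refine Ideal.span_le.2 ?_
    rintro _ ⟨z, ⟨hyz, hzx⟩, rfl⟩
    exact Ideal.subset_span ⟨y, z, eliminate_adj.2 ⟨hyz, hxy.ne', hzx⟩, rfl⟩
  have h' : edgeIdeal K (eliminate G (insert y (G.neighborSet y))) ≤
      edgeIdeal K (eliminate G {x}) := by
    refine Ideal.span_mono ?_
    rintro _ ⟨a, b, hab, rfl⟩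
    obtain ⟨hab, ha, hb⟩ := eliminate_adj.1 hab
    refine ⟨a, b, eliminate_adj.2 ⟨hab, ?_, ?_⟩, rfl⟩
    · rintro rfl
      exact ha (Or.inr hxy.symm)
    · rintro rfl
      exact hb (Or.inr hxy.symm)
  obtain ⟨p₁, hp₁, p₂, hp₂, rfl⟩ := Submodule.mem_sup.1 hp
  rw [mul_add]
  exact Ideal.add_mem _ (Ideal.mul_mem_left _ _ (h' hp₁)) (h hp₂)

/-- The colon ideal `I(G \ x) : x y` of a leaf `x` with neighbour `y` is generated by the other
neighbours of `y` and the edges at distance at least two from `y`. -/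
theorem mem_colon_of_mul_mem {p : MvPolynomial V K}
    (hp : X x * X y * p ∈ edgeIdeal K (eliminate G {x})) :
    p ∈ edgeIdeal K (eliminate G (insert y (G.neighborSet y))) ⊔
      Ideal.span (X '' {z | G.Adj y z ∧ z ≠ x}) := by
  classical
  rw [mem_edgeIdeal_sup_iff]
  rw [mem_edgeIdeal_iff] at hp
  intro e he
  rw [mul_assoc] at hp
  obtain ⟨a, b, hab, ha, hb⟩ := hp _ (mem_support_X_mul (mem_support_X_mul he y) x)
  obtain ⟨hab, hax, hbx⟩ := eliminate_adj.1 hab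
  rw [Set.mem_singleton_iff] at hax hbx
  simp only [Finsupp.add_apply, Finsupp.single_apply, if_neg (Ne.symm hax),
    if_neg (Ne.symm hbx), zero_add] at ha hb
  by_cases hay : y = a
  · subst hay
    rw [if_neg hab.ne, zero_add] at hb
    exact Or.inr ⟨b, ⟨hab, hbx⟩, hb⟩
  by_cases hby : y = b
  · subst hby
    rw [if_neg hay, zero_add] at ha
    exact Or.inr ⟨a, ⟨hab.symm, hax⟩, ha⟩
  rw [if_neg hay, zero_add] at ha
  rw [if_neg hby, zero_add] at hb
  by_cases ha' : G.Adj y a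
  · exact Or.inr ⟨a, ⟨ha', hax⟩, ha⟩
  by_cases hb' : G.Adj y b
  · exact Or.inr ⟨b, ⟨hb', hbx⟩, hb⟩
  refine Or.inl ⟨a, b, eliminate_adj.2 ⟨hab, ?_, ?_⟩, ha, hb⟩
  · simp [Ne.symm hay, ha']
  · simp [Ne.symm hby, hb']

end Leaf

/-! ### Leaves of forests -/

theorem exists_leaf [Finite V] {G : SimpleGraph V} (hG : G.IsAcyclic) (hne : G ≠ ⊥) :
    ∃ x y, G.Adj x y ∧ ∀ z, G.Adj x z → z = y := by
  have := Fintype.ofFinite V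
  obtain ⟨a, b, hab⟩ := SimpleGraph.ne_bot_iff_exists_adj.1 hne
  -- The first vertex of a longest path is a leaf.
  let P : ℕ → Prop := fun n => ∃ (u w : V) (p : G.Walk u w), p.IsPath ∧ p.length = n
  have hP : ∀ n, P n → n ≤ Fintype.card V := by
    rintro n ⟨u, w, p, hp, rfl⟩
    exact hp.length_lt.le
  classical
  have h1 : P 1 := ⟨a, b, hab.toWalk, by simp [hab.ne], by simp⟩
  obtain ⟨u, w, p, hp, hlen⟩ : P (Nat.findGreatest P (Fintype.card V)) :=
    Nat.findGreatest_spec (hP 1 h1) h1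
  have hmax : ∀ n, P n → n ≤ p.length := fun n hn => by
    rw [hlen]
    exact Nat.le_findGreatest (hP n hn) hn
  have hnil : ¬ p.Nil := by
    rw [← SimpleGraph.Walk.length_eq_zero_iff]
    have := hmax 1 h1
    omega
  refine ⟨u, p.snd, p.adj_snd hnil, fun z hz => ?_⟩
  by_contra hne
  have hzp : z ∉ p.support := fun hzp => hne (hG.eq_snd_of_adj_start hp hz hzp)
  have := hmax _ ⟨z, w, SimpleGraph.Walk.cons hz.symm p, hp.cons hzp, rfl⟩
  simp at this

/-! ### Minimal resolutions for forests -/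

theorem exists_resolution_bot :
    Nonempty (MinimalGradedFreeResolution (⊥ : Ideal (MvPolynomial V K))) := by
  let aug : (Unit → MvPolynomial V K) →ₗ[MvPolynomial V K]
      (MvPolynomial V K ⧸ (⊥ : Ideal (MvPolynomial V K))) :=
    Submodule.mkQ _ ∘ₗ LinearMap.proj ()
  have haug : ∀ f, aug f = Ideal.Quotient.mk ⊥ (f ()) := fun f => rfl
  obtain ⟨F, -⟩ := MinimalGradedFreeResolution.exists_of_fintype_succ
    (I := (⊥ : Ideal (MvPolynomial V K))) Unit (fun _ => Empty) 0 (fun _ => 0) 0 (fun _ => 0) aug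
    (fun i => i.elim) (fun _ i => i.elim)
    (fun i => ⟨1, inDegree_one, by simp [haug]⟩)
    (fun z => by
      obtain ⟨p, rfl⟩ := Ideal.Quotient.mk_surjective z
      exact ⟨fun _ => p, rfl⟩)
    (fun f => by
      rw [haug, Ideal.Quotient.eq_zero_iff_mem, Ideal.mem_bot]
      constructor
      · exact fun h => ⟨0, funext fun _ => h.symm⟩
      · rintro ⟨_, rfl⟩
        rfl)
    (fun f => ⟨fun _ => ⟨0, Subsingleton.elim _ _⟩, fun _ => rfl⟩)
    (fun r f => ⟨fun _ => ⟨0, Subsingleton.elim _ _⟩, fun _ => Subsingleton.elim _ _⟩)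
    (fun i => i.elim) (fun _ i => i.elim)
  exact ⟨F⟩

theorem sum_choose_succ_mul (f : ℕ → ℕ) (m : ℕ) :
    ∑ j ∈ Finset.range (m + 2), (m + 1).choose j * f j =
      ∑ j ∈ Finset.range (m + 1), m.choose j * f j +
        ∑ j ∈ Finset.range (m + 1), m.choose j * f (j + 1) := by
  rw [Finset.sum_range_succ' _ (m + 1)]
  simp only [Nat.choose_succ_succ, add_mul, Finset.sum_add_distrib]
  have h : ∑ j ∈ Finset.range (m + 1), m.choose j * f j =
      ∑ j ∈ Finset.range (m + 1), m.choose (j + 1) * f (j + 1) + f 0 := by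
    have h1 := Finset.sum_range_succ (fun j => m.choose j * f j) (m + 1)
    rw [Finset.sum_range_succ' _ (m + 1)] at h1
    simpa using h1.symm
  rw [h]
  simp only [Nat.choose_zero_right, one_mul]
  ring

/-- Variables at isolated vertices of `G` form a regular sequence modulo `I(G)`. Adjoining one of them
adds, by the mapping cone of its multiplication map, a copy of the resolution moved up by one in both
degrees. -/
theorem exists_resolution_sup_span_X {G : SimpleGraph V}
    (F : MinimalGradedFreeResolution (edgeIdeal K G)) (S : Finset V)
    (hS : ∀ z ∈ S, ∀ a, ¬ G.Adj z a) :
    ∃ H : MinimalGradedFreeResolution (edgeIdeal K G ⊔ Ideal.span (X '' (S : Set V))),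
      ∀ r d : ℤ, H.count r d =
        ∑ j ∈ Finset.range (S.card + 1), S.card.choose j * F.count (r - j) (d - j) := by
  classical
  induction S using Finset.induction_on with
  | empty =>
    rw [Finset.coe_empty, Set.image_empty, Ideal.span_empty, sup_bot_eq]
    exact ⟨F, by simp⟩
  | insert z S hz ih =>
    obtain ⟨H, hH⟩ := ih fun a ha => hS a (Finset.mem_insert_of_mem ha)
    obtain ⟨H', hH'⟩ := MinimalGradedFreeResolution.exists_cone
      (I := edgeIdeal K G ⊔ Ideal.span (X '' ((insert z S : Finset V) : Set V))) H H
      (isHomogeneous_edgeIdeal_sup G S) z inDegree_one (by simp)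
      (fun p hp => by
        rw [mul_one, mem_edgeIdeal_sup_iff] at hp
        rw [mem_edgeIdeal_sup_iff]
        intro e he
        have key : ∀ a, a ≠ z → (Finsupp.single z 1 + e : V →₀ ℕ) a ≠ 0 → e a ≠ 0 := by
          intro a ha h
          simpa [Finsupp.single_apply, Ne.symm ha] using h
        obtain ⟨a, b, hab, ha, hb⟩ | ⟨a, haS, ha⟩ := hp _ (mem_support_X_mul he z)
        · refine Or.inl ⟨a, b, hab, key a ?_ ha, key b ?_ hb⟩
          · rintro rfl
            exact hS a (Finset.mem_insert_self _ _) b hab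
          · rintro rfl
            exact hS b (Finset.mem_insert_self _ _) a hab.symm
        · refine Or.inr ⟨a, haS, key a ?_ ha⟩
          rintro rfl
          exact hz haS)
      (by
        rw [mul_one, Finset.coe_insert, Set.image_insert_eq, Set.insert_eq, Ideal.span_union,
          sup_assoc, sup_comm (Ideal.span {X z})])
    refine ⟨H', fun r d => ?_⟩
    rw [hH', hH, hH, Finset.card_insert_of_notMem hz,
      sum_choose_succ_mul fun j => F.count (r - j) (d - j)]
    congr 1
    refine Finset.sum_congr rfl fun j _ => ?_
    congr 2 <;> push_cast <;> ring

/-- Deleting a leaf `x` with neighbour `y`: the resolution is a mapping cone of multiplication by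
`x y`, from the quotient by the colon ideal `I(G \ x) : x y` to `R ⧸ I(G \ x)`. -/
theorem exists_resolution_of_leaf {G : SimpleGraph V} {x y : V} (hxy : G.Adj x y)
    (hx : ∀ z, G.Adj x z → z = y) (N : Finset V) (hN : ∀ z, z ∈ N ↔ G.Adj y z ∧ z ≠ x)
    (F' : MinimalGradedFreeResolution (edgeIdeal K (eliminate G {x})))
    (F'' : MinimalGradedFreeResolution
      (edgeIdeal K (eliminate G (insert y (G.neighborSet y))))) :
    ∃ H : MinimalGradedFreeResolution (edgeIdeal K G), ∀ r d : ℤ,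
      H.count r d = F'.count r d + ∑ j ∈ Finset.range (N.card + 1),
        N.card.choose j * F''.count (r - (j + 1)) (d - (j + 2)) := by
  have hN' : (N : Set V) = {z | G.Adj y z ∧ z ≠ x} := Set.ext hN
  obtain ⟨L, hL⟩ := exists_resolution_sup_span_X F'' N fun z hz a hza =>
    (eliminate_adj.1 hza).2.1 (Or.inr ((hN z).1 hz).1)
  obtain ⟨H, hH⟩ := MinimalGradedFreeResolution.exists_cone (I := edgeIdeal K G) F' L
    (isHomogeneous_edgeIdeal _) x (inDegree_X y)
    (fun p hp => X_mul_mem_of_mem_colon (by rwa [← hN']) hxy)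
    (fun p hp => by
      rw [hN']
      exact mem_colon_of_mul_mem hp)
    (edgeIdeal_eq_sup_of_leaf hxy hx)
  refine ⟨H, fun r d => ?_⟩
  rw [hH, hL]
  congr 1
  refine Finset.sum_congr rfl fun j _ => ?_
  congr 2 <;> ring

theorem exists_resolution_of_isAcyclic [Finite V] (G : SimpleGraph V) (hG : G.IsAcyclic) :
    Nonempty (MinimalGradedFreeResolution (edgeIdeal K G)) := by
  classical
  have := Fintype.ofFinite V
  induction G using WellFoundedLT.induction with
  | ind G ih =>
    by_cases hne : G = ⊥
    · have : edgeIdeal K G = ⊥ := by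
        rw [edgeIdeal, Ideal.span_eq_bot]
        rintro _ ⟨a, b, hab, -⟩
        rw [hne] at hab
        exact hab.elim
      rw [this]
      exact exists_resolution_bot
    obtain ⟨x, y, hxy, hx⟩ := exists_leaf hG hne
    have hlt : ∀ S : Set V, x ∈ S ∨ y ∈ S → eliminate G S < G := fun S hS =>
      lt_of_le_of_ne (eliminate_le G S) fun h => by
        have := eliminate_adj.1 (h.symm ▸ hxy)
        tauto
    obtain ⟨F'⟩ := ih (eliminate G {x}) (hlt _ (Or.inl rfl)) (hG.anti (eliminate_le _ _))
    obtain ⟨F''⟩ := ih (eliminate G (insert y (G.neighborSet y))) (hlt _ (Or.inr (Or.inl rfl)))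
      (hG.anti (eliminate_le _ _))
    obtain ⟨H, -⟩ := exists_resolution_of_leaf hxy hx
      (Finset.univ.filter fun z => G.Adj y z ∧ z ≠ x) (by simp) F' F''
    exact ⟨H⟩

/-! ### The recursion -/

theorem pd_edgeIdeal_nonneg (G : SimpleGraph V) : 0 ≤ pd (edgeIdeal K G) := by
  rw [← not_lt]
  intro h
  have h1 : pd (edgeIdeal K G) < ((0 : ℕ) : WithBot ℕ∞) := by simpa using h
  rw [pd, CategoryTheory.projectiveDimension_lt_iff,
    CategoryTheory.hasProjectiveDimensionLT_zero_iff_isZero, ModuleCat.isZero_iff_subsingleton] at h1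
  have h2 : (1 : MvPolynomial V K) ∈ edgeIdeal K G := by
    rw [← Ideal.Quotient.eq_zero_iff_mem]
    exact Subsingleton.elim (α := ModuleCat.of (MvPolynomial V K)
      (MvPolynomial V K ⧸ edgeIdeal K G)) _ _
  obtain ⟨a, b, -, ha, -⟩ := (mem_edgeIdeal_iff G 1).1 h2 0 (by simp)
  exact ha rfl

theorem withBot_enat_eq_of_forall_lt {a b : WithBot ℕ∞} (h : ∀ n : ℕ, a < n ↔ b < n) : a = b := by
  have key : ∀ {a b : WithBot ℕ∞}, (∀ n : ℕ, a < n → b < n) → b ≤ a := by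
    intro a b h
    induction a with
    | bot =>
      have := h 0 (WithBot.bot_lt_coe _)
      rw [Nat.cast_zero, ← WithBot.coe_zero, ← bot_eq_zero', WithBot.lt_coe_bot] at this
      exact this.le
    | coe a =>
      induction a with
      | top => exact le_top
      | coe a =>
        have := h (a + 1) (by
          norm_cast
          exact Nat.lt_succ_self a)
        push_cast at this
        exact ENat.WithBot.lt_add_one_iff.1 this
  exact le_antisymm (key fun n => (h n).2) (key fun n => (h n).1)

theorem withBot_enat_add_lt_iff {a : WithBot ℕ∞} (ha : 0 ≤ a) (n m : ℕ) :
    a + n < m ↔ n ≤ m ∧ a < ((m - n : ℕ) : WithBot ℕ∞) := by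
  induction a with
  | bot => exact absurd ha (by simp)
  | coe a =>
    induction a with
    | top =>
      have h : ∀ k : ℕ, ¬ ((⊤ : ℕ∞) : WithBot ℕ∞) < (k : WithBot ℕ∞) := fun k => by
        simp
      refine ⟨fun h1 => absurd h1 ?_, fun h1 => absurd h1.2 (h _)⟩
      have : ((⊤ : ℕ∞) : WithBot ℕ∞) + n = ((⊤ : ℕ∞) : WithBot ℕ∞) := by
        rw [← WithBot.coe_natCast, ← WithBot.coe_add, top_add]
      rw [this]
      exact h m
    | coe a =>
      have h1 : (((a : ℕ∞) : WithBot ℕ∞) + n < m) ↔ a + n < m := by norm_cast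
      have h2 : (((a : ℕ∞) : WithBot ℕ∞) < ((m - n : ℕ) : WithBot ℕ∞)) ↔ a < m - n := by
        generalize m - n = k
        norm_cast
      rw [h1, h2]
      omega

/-- The recursion for projective dimensions follows from the one for graded Betti numbers, as
`pd (R ⧸ I)` is the largest `r` such that `β_{r,d} ≠ 0` for some `d`. -/
theorem pd_eq_max_of_gradedBetti [Finite V] {G G' G'' : SimpleGraph V} (hG : G.IsAcyclic)
    (hG' : G'.IsAcyclic) (hG'' : G''.IsAcyclic) {n : ℕ} (hn : 0 < n)
    (h : ∀ r d : ℤ, gradedBetti (edgeIdeal K G) r d = gradedBetti (edgeIdeal K G') r d +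
      ∑ j ∈ Finset.range n, (n - 1).choose j *
        gradedBetti (edgeIdeal K G'') (r - ((j : ℤ) + 1)) (d - ((j : ℤ) + 2))) :
    pd (edgeIdeal K G) = max (pd (edgeIdeal K G')) (pd (edgeIdeal K G'') + (n : WithBot ℕ∞)) := by
  have hpd : ∀ {G : SimpleGraph V}, G.IsAcyclic → ∀ m : ℕ, pd (edgeIdeal K G) < m ↔
      ∀ d : ℤ, gradedBetti (edgeIdeal K G) m d = 0 := fun {G} hG m => by
    obtain ⟨F⟩ := exists_resolution_of_isAcyclic (K := K) G hG
    exact F.pd_lt_iff (isHomogeneous_edgeIdeal G) m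
  refine withBot_enat_eq_of_forall_lt fun m => ?_
  rw [max_lt_iff, withBot_enat_add_lt_iff (pd_edgeIdeal_nonneg _), hpd hG, hpd hG']
  simp only [h, Nat.add_eq_zero_iff, Finset.sum_eq_zero_iff, Finset.mem_range, mul_eq_zero]
  rw [forall_and]
  refine and_congr_right fun hm => ?_
  have hm0 : m ≠ 0 := by
    rintro rfl
    exact (pd_edgeIdeal_nonneg (K := K) G').not_gt (by simpa using (hpd hG' 0).2 hm)
  have hchoose : ∀ j, j < n → (n - 1).choose j ≠ 0 := fun j hj =>
    (Nat.choose_pos (by omega)).ne'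
  constructor
  · intro h0
    have h1 : ∀ j k : ℕ, j < n → m = k + j + 1 → pd (edgeIdeal K G'') < k := by
      intro j k hj hk
      rw [hpd hG'']
      intro d
      have := (h0 (d + (j + 2)) j hj).resolve_left (hchoose j hj)
      rw [show (m : ℤ) - (j + 1) = k by omega, add_sub_cancel_right] at this
      exact this
    have hmn : n ≤ m := by
      by_contra hlt
      -- The summand `j = m - 1` would give `β_{0,·} = 0` for `G''`.
      have := h1 (m - 1) 0 (by omega) (by omega)
      exact (pd_edgeIdeal_nonneg (K := K) G'').not_gt (by simpa using this)
    exact ⟨hmn, h1 (n - 1) (m - n) (by omega) (by omega)⟩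
  · rintro ⟨hmn, hlt⟩ d j hj
    have h1 : pd (edgeIdeal K G'') < ((m - (j + 1) : ℕ) : WithBot ℕ∞) := by
      refine hlt.trans_le ?_
      norm_cast
      omega
    rw [hpd hG''] at h1
    right
    rw [show (m : ℤ) - (j + 1) = ((m - (j + 1) : ℕ) : ℤ) by omega]
    exact h1 _

end EdgeIdealBetti

theorem mainTheorem3 {V : Type*} [Fintype V] {K : Type*} [Field K]
    (T : SimpleGraph V) [DecidableRel T.Adj] (hT : T.IsTree)
    (v : V) (n : ℕ) (hn : 0 < n) (w : Fin n → V)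
    (hw_inj : Function.Injective w) (hw_range : Set.range w = T.neighborSet v)
    (hw_leaf : ∀ i : Fin n, (i : ℕ) + 1 < n → T.degree (w i) = 1)
    (hw_first : T.degree (w ⟨0, hn⟩) = 1) :
    (∀ r d : ℤ,
      EdgeIdealBetti.gradedBetti (EdgeIdealBetti.edgeIdeal K T) r d =
        EdgeIdealBetti.gradedBetti
          (EdgeIdealBetti.edgeIdeal K (EdgeIdealBetti.eliminate T {w ⟨0, hn⟩})) r d +
        ∑ j ∈ Finset.range n, (n - 1).choose j *
          EdgeIdealBetti.gradedBetti
            (EdgeIdealBetti.edgeIdeal K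
              (EdgeIdealBetti.eliminate T (insert v (Set.range w))))
            (r - ((j : ℤ) + 1)) (d - ((j : ℤ) + 2))) ∧
    EdgeIdealBetti.pd (EdgeIdealBetti.edgeIdeal K T) =
      max
        (EdgeIdealBetti.pd
          (EdgeIdealBetti.edgeIdeal K (EdgeIdealBetti.eliminate T {w ⟨0, hn⟩})))
        (EdgeIdealBetti.pd
          (EdgeIdealBetti.edgeIdeal K
            (EdgeIdealBetti.eliminate T (insert v (Set.range w)))) + (n : WithBot ℕ∞)) := by

  have hvw : T.Adj (w ⟨0, hn⟩) v := by
    have : w ⟨0, hn⟩ ∈ T.neighborSet v := hw_range ▸ Set.mem_range_self _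
    exact this.symm
  have hleaf : ∀ z, T.Adj (w ⟨0, hn⟩) z → z = v := by
    obtain ⟨u, -, hu⟩ := SimpleGraph.degree_eq_one_iff_existsUnique_adj.1 hw_first
    exact fun z hz => (hu z hz).trans (hu v hvw).symm
  have hT' := hT.isAcyclic
  have hacyc : ∀ S, (EdgeIdealBetti.eliminate T S).IsAcyclic := fun S =>
    hT'.anti (EdgeIdealBetti.eliminate_le T S)
  have hbetti : ∀ r d : ℤ,
      EdgeIdealBetti.gradedBetti (EdgeIdealBetti.edgeIdeal K T) r d =
        EdgeIdealBetti.gradedBetti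
          (EdgeIdealBetti.edgeIdeal K (EdgeIdealBetti.eliminate T {w ⟨0, hn⟩})) r d +
        ∑ j ∈ Finset.range n, (n - 1).choose j *
          EdgeIdealBetti.gradedBetti
            (EdgeIdealBetti.edgeIdeal K
              (EdgeIdealBetti.eliminate T (insert v (Set.range w))))
            (r - ((j : ℤ) + 1)) (d - ((j : ℤ) + 2)) := by
    intro r d
    classical
    rw [hw_range]
    obtain ⟨F'⟩ := EdgeIdealBetti.exists_resolution_of_isAcyclic (K := K) _
      (hacyc {w ⟨0, hn⟩})
    obtain ⟨F''⟩ := EdgeIdealBetti.exists_resolution_of_isAcyclic (K := K) _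
      (hacyc (insert v (T.neighborSet v)))
    obtain ⟨H, hH⟩ := EdgeIdealBetti.exists_resolution_of_leaf hvw hleaf
      ((Finset.univ.erase ⟨0, hn⟩).image w) (fun z => by
        have hz : T.Adj v z ↔ z ∈ Set.range w := by rw [hw_range]; rfl
        rw [hz]
        simp only [Finset.mem_image, Finset.mem_erase, Finset.mem_univ, and_true]
        constructor
        · rintro ⟨i, hi, rfl⟩
          exact ⟨⟨i, rfl⟩, fun h => hi (hw_inj h)⟩
        · rintro ⟨⟨i, rfl⟩, hi⟩
          exact ⟨i, fun h => hi (by rw [h]), rfl⟩) F' F''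
    have hcard : ((Finset.univ.erase (⟨0, hn⟩ : Fin n)).image w).card = n - 1 := by
      rw [Finset.card_image_of_injective _ hw_inj, Finset.card_erase_of_mem (Finset.mem_univ _),
        Finset.card_univ, Fintype.card_fin]
    rw [hcard, Nat.sub_add_cancel hn] at hH
    simp only [H.gradedBetti_eq_count (EdgeIdealBetti.isHomogeneous_edgeIdeal _),
      F'.gradedBetti_eq_count (EdgeIdealBetti.isHomogeneous_edgeIdeal _),
      F''.gradedBetti_eq_count (EdgeIdealBetti.isHomogeneous_edgeIdeal _)]
    exact hH r d
  exact ⟨hbetti, EdgeIdealBetti.pd_eq_max_of_gradedBetti hT' (hacyc _) (hacyc _) hn hbetti⟩
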